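/- Let $A,B$ be real symmetric $4\times 4$ matrices and let $f(\lambda)=\det(\lambda A-B)$, regarded as a quartic form in the projective variable $\lambda$ (so $\infty$ is a root exactly when $\det A=0$). Suppose that the roots of $f(\lambda)=0$ are two distinct real roots (in $\mathbb{PR}^1=\mathbb R\cup\{\infty\}$) and one pair of complex conjugate non-real roots. Then the following hold. (1) The index sequence of the pencil $\lambda A-B$ is $\langle 1|2|3\rangle$ up to equivalence. That is: for every pair of generators $A'=aA+bB$, $B'=cA+dB$ of the pencil ($ad-bc\ne 0$) with $A'$ nonsingular, every real root of $\det(\lambda A'-B')=0$ belongs to a single $1\times1$ Jordan block of $A'^{-1}B'$, and the index sequence of $(A',B')$ is equivalent to $\langle 1|2|3\rangle$; moreover, for some such generators it is exactly $\langle 1|2|3\rangle$. Here the index of a real symmetric matrix is its number of positive eigenvalues; for $A'$ nonsingular and $\lambda_1<\dots<\lambda_r$ the distinct real roots of $\det(\lambda A'-B')=0$, the index sequence of $(A',B')$ is $\langle s_0|s_1|\cdots|s_r\rangle$, where $s_0=\operatorname{index}(-A')$, $s_r=\operatorname{index}(A')$, and $s_j=\operatorname{index}(\mu A'-B')$ for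 $\lambda_j<\mu<\lambda_{j+1}$, each bar $|$ standing for a real root associated with a single $1\times 1$ Jordan block. Equivalence of index sequences is generated by the rotations $\langle s_0|\cdots|s_r\rangle\sim\langle 4-s_{r-1}|s_0|\cdots|s_{r-1}\rangle$ and $\langle s_0|\cdots|s_r\rangle\sim\langle s_1|\cdots|s_r|4-s_1\rangle$, the reversal $\langle s_0|\cdots|s_r\rangle\sim\langle s_r|\cdots|s_0\rangle$ and the complement $\langle s_0|\cdots|s_r\rangle\sim\langle 4-s_0|\cdots|4-s_r\rangle$. (2) The intersection curve $\{X\in\mathbb{PR}^3: X^TAX=X^TBX=0\}$ consists of exactly one connected component; this component is homeomorphic to a circle, and it is closed, i.e. there is a plane of $\mathbb{PR}^3$ that does not meet it. -/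

import Mathlib

open scoped Matrix LinearAlgebra.Projectivization

noncomputable section

/-! ### The pencil `λ A - B` and its characteristic equation -/

/-- Real `4 × 4` matrices. -/
abbrev Mat4 : Type := Matrix (Fin 4) (Fin 4) ℝ

/-- `ρ ∈ ℂ ∪ {∞}` is a root of the characteristic equation `f(λ) = det (λ A - B) = 0`, where `f` is
read as a form of degree `4` in a projective variable, i.e. as the binary quartic form
`det (s A - t B)` with `λ = s / t`.  Its value at `λ = ∞ = [1 : 0]` is `det A`. -/
def IsCharRoot (A B : Mat4) (ρ : OnePoint ℂ) : Prop :=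
  ρ.elim (A.det = 0)
    (fun z : ℂ => (z • A.map (fun a : ℝ => (a : ℂ)) - B.map (fun b : ℝ => (b : ℂ))).det = 0)

/-- The real projective line `ℝ ∪ {∞}` inside the complex one. -/
def realPoint (x : OnePoint ℝ) : OnePoint ℂ := x.map (fun a : ℝ => (a : ℂ))

/-- The roots of the characteristic equation are two distinct points of the real projective line and
one pair of complex conjugate (non-real) numbers.  (These are four distinct roots of a form of
degree `4`, which therefore does not vanish identically and has only simple roots.) -/
def HasTwoRealRootsAndOneConjPair (A B : Mat4) : Prop :=
  ∃ (x y : OnePoint ℝ) (z : ℂ), x ≠ y ∧ z.im ≠ 0 ∧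
    {ρ : OnePoint ℂ | IsCharRoot A B ρ} =
      {realPoint x, realPoint y, (z : OnePoint ℂ), ((starRingEnd ℂ z : ℂ) : OnePoint ℂ)}

/-- `(A', B')` is another pair of generators of the pencil spanned by `A` and `B`; this amounts to
a projective change of the parameter `λ`. -/
def GeneratesSamePencil (A B A' B' : Mat4) : Prop :=
  ∃ a b c d : ℝ, a * d - b * c ≠ 0 ∧ A' = a • A + b • B ∧ B' = c • A + d • B

/-! ### Index sequences -/

/-- The index (number of positive squares in the Sylvester normal form) of a symmetric matrix. -/
def matIndex (D : Mat4) : ℕ := sigPos D.toQuadraticForm'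

/-- `⟨s₀ | s₁ | ⋯ | s_r⟩` is the index sequence of the pair `(A, B)`, where `A` is nonsingular.
The numbers `lam 0 < ⋯ < lam (r - 1)` are all the distinct real roots of `det (λ A - B) = 0`.
The outer entries are `Id(-∞) = index (-A)` and `Id(∞) = index A`, the inner ones are the values of
the index function at any separating number.  Each separator being a single bar `|` means that each
real root belongs to exactly one Jordan block of `A⁻¹ B`, of size `1 × 1`, i.e. that its
generalized eigenspace is a line.  (A pair with a real root of another type has no index
sequence of this form.) -/
def HasBarIndexSequence (A B : Mat4) (s : List ℕ) : Prop :=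
  A.det ≠ 0 ∧ ∃ (r : ℕ) (lam : Fin r → ℝ) (t : Fin (r + 1) → ℕ),
    StrictMono lam ∧
    Set.range lam = {x : ℝ | (x • A - B).det = 0} ∧
    (∀ j, Module.finrank ℝ
      (Module.End.maxGenEigenspace (Matrix.toLin' (A⁻¹ * B)) (lam j)) = 1) ∧
    t 0 = matIndex (-A) ∧
    t (Fin.last r) = matIndex A ∧
    (∀ i j : Fin r, (j : ℕ) = i + 1 → ∀ μ ∈ Set.Ioo (lam i) (lam j),
      t i.succ = matIndex (μ • A - B)) ∧
    s = List.ofFn t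

/-- The general properties `s_j ∈ {0, …, 4}` and `s₀ + s_r = 4` of index sequences. -/
def IsAdmissibleSeq (s : List ℕ) : Prop :=
  (∀ n ∈ s, n ≤ 4) ∧ ∃ h : s ≠ [], s.head h + s.getLast h = 4

/-- The elementary moves between index sequences (all separators being `|`). -/
inductive IndexSeqMove : List ℕ → List ℕ → Prop
  /-- `⟨s₀ | ⋯ | s_{r-1} | s_r⟩ ∼ ⟨4 - s_{r-1} | s₀ | ⋯ | s_{r-1}⟩` -/
  | rotateRight (l : List ℕ) (m n : ℕ) (h : IsAdmissibleSeq (l ++ [m, n])) :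
      IndexSeqMove (l ++ [m, n]) ((4 - m) :: (l ++ [m]))
  /-- `⟨s₀ | s₁ | ⋯ | s_r⟩ ∼ ⟨s₁ | ⋯ | s_r | 4 - s₁⟩` -/
  | rotateLeft (l : List ℕ) (m n : ℕ) (h : IsAdmissibleSeq (m :: n :: l)) :
      IndexSeqMove (m :: n :: l) (n :: l ++ [4 - n])
  /-- `⟨s₀ | ⋯ | s_r⟩ ∼ ⟨s_r | ⋯ | s₀⟩` -/
  | reversal (l : List ℕ) (h : IsAdmissibleSeq l) : IndexSeqMove l l.reverse
  /-- `⟨s₀ | ⋯ | s_r⟩ ∼ ⟨4 - s₀ | ⋯ | 4 - s_r⟩` -/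
  | complement (l : List ℕ) (h : IsAdmissibleSeq l) : IndexSeqMove l (l.map (fun n => 4 - n))

/-- Equivalence of index sequences: generated by rotation, reversal and complement. -/
def IndexSeqEquiv : List ℕ → List ℕ → Prop := Relation.EqvGen IndexSeqMove

/-! ### The intersection curve in real projective space -/

/-- Real projective `3`-space. -/
abbrev RP3 : Type := ℙ ℝ (Fin 4 → ℝ)

/-- Real projective space carries the quotient topology from `ℝ⁴ ∖ {0}`. -/
instance RP3.instTopologicalSpace : TopologicalSpace RP3 :=
  inferInstanceAs (TopologicalSpace (Quotient (projectivizationSetoid ℝ (Fin 4 → ℝ))))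

/-- The quadric `Xᵀ A X = 0` (the condition does not depend on the representative of a point). -/
def quadric (A : Mat4) : Set RP3 := {p | p.rep ⬝ᵥ (A *ᵥ p.rep) = 0}

/-- The quadric surface intersection curve of `Xᵀ A X = 0` and `Xᵀ B X = 0`. -/
def qsic (A B : Mat4) : Set RP3 := quadric A ∩ quadric B

/-- The plane with coefficient vector `n`. -/
def projPlane (n : Fin 4 → ℝ) : Set RP3 := {p | n ⬝ᵥ p.rep = 0}

/-- The set of connected components of a subset of projective space. -/
def componentsOf (S : Set RP3) : Set (Set RP3) := {C | ∃ p ∈ S, C = connectedComponentIn S p}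

/-- A component is open if every plane meets it. -/
def IsOpenComponent (C : Set RP3) : Prop := ∀ n : Fin 4 → ℝ, n ≠ 0 → (C ∩ projPlane n).Nonempty

/-- A component is closed if some plane does not meet it. -/
def IsClosedComponent (C : Set RP3) : Prop := ¬ IsOpenComponent C

end

/-!
For a nonsingular generator pair `(A, B)` of the pencil, real eigenvectors for the two real roots
`l₁ < l₂` together with the real and imaginary parts of an eigenvector for a non-real root `p + i q`
form a basis in which `A` and `B` are simultaneously block diagonal (`exists_normalForm`): symmetry
makes eigenvectors for distinct roots `A`-orthogonal, and orthogonality of a non-real eigenvector to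
its conjugate makes the last `2 × 2` block trace-free. So in suitable coordinates `(x, y, ω)` with
`ω = ξ + i η` complex, the form of `μ A - B` is
`(μ - l₁) a₁ x² + (μ - l₂) a₂ y² + Re (k (μ - p - i q)^* ω²)` for a constant `k ≠ 0`, where `^*`
denotes complex conjugation.

A trace-free block contributes exactly one positive square for every real `μ`. Hence, by Sylvester's
law of inertia, the index sequence is `⟨1|2|3⟩`, `⟨2|3|2⟩`, `⟨2|1|2⟩` or `⟨3|2|1⟩` according to the
signs of `a₁` and `a₂` (`IsNormalForm.hasBarIndexSequence`). These four are equivalent, and the pencil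
has a nonsingular member of index `3`, which can only end the sequence `⟨1|2|3⟩`. A change of
generators acts on the roots by a real projective transformation, so every nonsingular generator pair
has such a normal form (`HasTwoRealRootsAndOneConjPair.exists_normalForm`).

For the curve, the singular members `μ = l₂` and `μ = l₁` express `x²` and `y²` as two linearly
independent trace-free forms in `(ξ, η)`. In coordinates `s`, `t` that vanish on the edges of the
wedge where both forms are nonnegative, the curve becomes `x² = s (a s + b t)`,
`y² = t (c s + d t)` with `a, b, c, d > 0` and `a d < b c` (`exists_wedge_coordinates`). It is
parametrized injectively by the unit circle `σ² + ρ² = 1`, with `s = σ²`, `t = ρ²`,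
`x = σ √(a s + b t)`, `y = ρ √(c s + d t)`, and it misses the plane `s + t = 0` (`curve_isCircle`).
-/

/-! ### Topology of the real projective space -/

lemma RP3.continuous_mk {X : Type*} [TopologicalSpace X] {f : X → Fin 4 → ℝ}
    (hf : Continuous f) (h0 : ∀ x, f x ≠ 0) :
    Continuous fun x => (Projectivization.mk ℝ (f x) (h0 x) : RP3) :=
  (continuous_quotient_mk' (s := projectivizationSetoid ℝ (Fin 4 → ℝ))).comp
    (hf.subtype_mk h0)

lemma dotProduct_self_ne_zero {v : Fin 4 → ℝ} (hv : v ≠ 0) : v ⬝ᵥ v ≠ 0 := by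
  rwa [Ne, dotProduct_self_eq_zero]

/-- The entries of the orthogonal projection of `ℝ⁴` onto the line `p`. -/
noncomputable def RP3.lineProjection (p : RP3) : Fin 4 → Fin 4 → ℝ :=
  Projectivization.lift
    (fun (v : {v : Fin 4 → ℝ // v ≠ 0}) (i j : Fin 4) => v.1 i * v.1 j / (v.1 ⬝ᵥ v.1)) (by
    rintro ⟨v, hv⟩ ⟨w, hw⟩ t (rfl : v = t • w)
    have ht : t ≠ 0 := by rintro rfl; simp at hv
    have hw' := dotProduct_self_ne_zero hw
    funext i j
    simp only [dotProduct_smul, smul_dotProduct, Pi.smul_apply, smul_eq_mul]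
    field_simp) p

lemma RP3.continuous_lineProjection : Continuous RP3.lineProjection := by
  refine continuous_quot_lift _ ?_
  refine continuous_pi fun i => continuous_pi fun j => ?_
  refine Continuous.div ?_ ?_ fun v => dotProduct_self_ne_zero v.2
  · exact ((continuous_apply i).comp continuous_subtype_val).mul
      ((continuous_apply j).comp continuous_subtype_val)
  · exact continuous_subtype_val.dotProduct continuous_subtype_val

lemma RP3.lineProjection_injective : Function.Injective RP3.lineProjection := by
  intro p q h
  induction p using Projectivization.ind with | h v hv =>
  induction q using Projectivization.ind with | h w hw =>
  have h' : ∀ i j, v i * v j / (v ⬝ᵥ v) = w i * w j / (w ⬝ᵥ w) := fun i j =>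
    congrFun (congrFun h i) j
  obtain ⟨j, hj⟩ : ∃ j, v j ≠ 0 := Function.ne_iff.mp hv
  have hv' := dotProduct_self_ne_zero hv
  have hw' := dotProduct_self_ne_zero hw
  rw [Projectivization.mk_eq_mk_iff']
  refine ⟨w j * (v ⬝ᵥ v) / (v j * (w ⬝ᵥ w)), ?_⟩
  funext i
  have := h' i j
  simp only [Pi.smul_apply, smul_eq_mul]
  field_simp at this ⊢
  linarith

/-- Real projective space is Hausdorff: it embeds continuously into the space of matrices. -/
instance RP3.instT2Space : T2Space RP3 :=
  T2Space.of_injective_continuous RP3.lineProjection_injective RP3.continuous_lineProjection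

/-! ### The curve `x² = s (a s + b t)`, `y² = t (c s + d t)` -/

/-- The parametrization of the cone over the curve `x² = s (a s + b t)`, `y² = t (c s + d t)` by the
unit circle `σ² + ρ² = 1`, where `s = σ²` and `t = ρ²`. -/
noncomputable def circleParam (a b c d : ℝ) (z : Circle) : Fin 4 → ℝ :=
  ![(z : ℂ).re * √(a * (z : ℂ).re ^ 2 + b * (z : ℂ).im ^ 2),
    (z : ℂ).im * √(c * (z : ℂ).re ^ 2 + d * (z : ℂ).im ^ 2),
    (z : ℂ).re ^ 2, (z : ℂ).im ^ 2]

lemma Circle.re_sq_add_im_sq (z : Circle) : (z : ℂ).re ^ 2 + (z : ℂ).im ^ 2 = 1 := by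
  have := Circle.normSq_coe z
  rw [Complex.normSq_apply] at this
  linarith

lemma continuous_circleParam (a b c d : ℝ) : Continuous (circleParam a b c d) := by
  unfold circleParam
  refine continuous_pi fun i => ?_
  fin_cases i <;> simp <;> fun_prop

lemma circleParam_sum (a b c d : ℝ) (z : Circle) :
    circleParam a b c d z 2 + circleParam a b c d z 3 = 1 := by
  simpa [circleParam] using Circle.re_sq_add_im_sq z

lemma circleParam_ne_zero (a b c d : ℝ) (z : Circle) : circleParam a b c d z ≠ 0 := by
  intro h
  have := circleParam_sum a b c d z
  simp [h] at this

lemma pos_of_sq_add_sq_eq_one {a b x y : ℝ} (ha : 0 < a) (hb : 0 < b) (h : x ^ 2 + y ^ 2 = 1) :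
    0 < a * x ^ 2 + b * y ^ 2 := by
  by_cases hx : x = 0
  · have : y ^ 2 = 1 := by simpa [hx] using h
    simp [hx, this, hb]
  · positivity

lemma circleParam_injective {a b c d : ℝ} (ha : 0 < a) (hb : 0 < b) (hc : 0 < c) (hd : 0 < d)
    {z w : Circle} {r : ℝ} (h : r • circleParam a b c d w = circleParam a b c d z) : z = w := by
  have hr : r = 1 := by
    have h2 := congrFun h 2
    have h3 := congrFun h 3
    have hz := circleParam_sum a b c d z
    have hw := circleParam_sum a b c d w
    simp only [Pi.smul_apply, smul_eq_mul] at h2 h3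
    linear_combination -r * hw + hz + h2 + h3
  subst hr
  rw [one_smul] at h
  have h0 : (w : ℂ).re * √(a * (w : ℂ).re ^ 2 + b * (w : ℂ).im ^ 2) =
    (z : ℂ).re * √(a * (z : ℂ).re ^ 2 + b * (z : ℂ).im ^ 2) := congrFun h 0
  have h1 : (w : ℂ).im * √(c * (w : ℂ).re ^ 2 + d * (w : ℂ).im ^ 2) =
    (z : ℂ).im * √(c * (z : ℂ).re ^ 2 + d * (z : ℂ).im ^ 2) := congrFun h 1
  have h2 : (w : ℂ).re ^ 2 = (z : ℂ).re ^ 2 := congrFun h 2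
  have h3 : (w : ℂ).im ^ 2 = (z : ℂ).im ^ 2 := congrFun h 3
  rw [h2, h3] at h0 h1
  have hz := Circle.re_sq_add_im_sq z
  have e0 := mul_right_cancel₀ (Real.sqrt_ne_zero'.mpr (pos_of_sq_add_sq_eq_one ha hb hz)) h0
  have e1 := mul_right_cancel₀ (Real.sqrt_ne_zero'.mpr (pos_of_sq_add_sq_eq_one hc hd hz)) h1
  exact Circle.ext (Complex.ext e0.symm e1.symm)

/-- A square root of `s` with the sign of `x`. -/
lemma exists_signed_sqrt {x s k : ℝ} (hs : 0 ≤ s) (h : x ^ 2 = s * k) :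
    ∃ σ : ℝ, σ ^ 2 = s ∧ x = σ * √k := by
  have hx : |x| = √s * √k := by rw [← Real.sqrt_mul hs, ← h, Real.sqrt_sq_eq_abs]
  rcases abs_choice x with h' | h'
  · exact ⟨√s, Real.sq_sqrt hs, by rw [← hx, h']⟩
  · exact ⟨-√s, by rw [neg_sq, Real.sq_sqrt hs], by rw [neg_mul, ← hx, h', neg_neg]⟩

/-- On the curve the coordinates `s` and `t` never have opposite signs; this is where the inequality
`a d < b c` enters. -/
lemma curve_not_opposite_signs {a b c d x y s t : ℝ} (ha : 0 < a) (hc : 0 < c)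
    (hbc : a * d < b * c) (hx : x ^ 2 = s * (a * s + b * t))
    (hy : y ^ 2 = t * (c * s + d * t)) (hs : 0 < s) (ht : t < 0) : False := by
  have h1 : 0 ≤ a * s + b * t := by
    by_contra! h
    have := mul_neg_of_pos_of_neg hs h
    nlinarith [sq_nonneg x]
  have h2 : c * s + d * t ≤ 0 := by
    by_contra! h
    have := mul_neg_of_neg_of_pos ht h
    nlinarith [sq_nonneg y]
  have h3 : c * (a * s + b * t) - a * (c * s + d * t) = (b * c - a * d) * t := by ring
  have h4 : (b * c - a * d) * t < 0 := mul_neg_of_pos_of_neg (by linarith) ht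
  have := mul_nonneg hc.le h1
  have := mul_nonneg ha.le (neg_nonneg.mpr h2)
  linarith

lemma exists_circleParam {a b c d : ℝ} (ha : 0 < a) (hc : 0 < c) (hd : 0 < d)
    (hbc : a * d < b * c) {w : Fin 4 → ℝ} (hw : w ≠ 0)
    (hx : w 0 ^ 2 = w 2 * (a * w 2 + b * w 3)) (hy : w 1 ^ 2 = w 3 * (c * w 2 + d * w 3)) :
    ∃ (r : ℝ) (z : Circle), r • w = circleParam a b c d z := by
  have hsum : w 2 + w 3 ≠ 0 := by
    intro h
    have h3 : w 3 = - w 2 := by linarith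
    rcases lt_trichotomy (w 2) 0 with h2 | h2 | h2
    · refine curve_not_opposite_signs (s := - w 2) (t := - w 3) ha hc hbc (x := w 0) (y := w 1)
        ?_ ?_ ?_ ?_
      · rw [hx]; ring
      · rw [hy]; ring
      · linarith
      · linarith
    · apply hw
      have h3' : w 3 = 0 := by simp [h3, h2]
      have h0 : w 0 = 0 := by simpa [h2, h3'] using hx
      have h1 : w 1 = 0 := by simpa [h2, h3'] using hy
      funext i
      fin_cases i <;> simp [h0, h1, h2, h3']
    · exact curve_not_opposite_signs ha hc hbc hx hy h2 (by linarith)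
  set r := (w 2 + w 3)⁻¹ with hr
  set s := r * w 2 with hs
  set t := r * w 3 with ht
  have hst : s + t = 1 := by rw [hs, ht, hr]; field_simp
  have hx' : (r * w 0) ^ 2 = s * (a * s + b * t) := by rw [mul_pow, hx, hs, ht]; ring
  have hy' : (r * w 1) ^ 2 = t * (c * s + d * t) := by rw [mul_pow, hy, hs, ht]; ring
  have ht0 : 0 ≤ t := by
    by_contra! h
    exact curve_not_opposite_signs ha hc hbc hx' hy' (by linarith) h
  have hs0 : 0 ≤ s := by
    by_contra! h
    -- exchange the roles of `(x, s)` and `(y, t)`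
    exact curve_not_opposite_signs (a := d) (b := c) (c := b) (d := a) (x := r * w 1)
      (y := r * w 0) (s := t) (t := s) hd
      (by by_contra! hb; nlinarith [mul_pos ha hd]) (by linarith)
      (by rw [hy']; ring) (by rw [hx']; ring) (by linarith) h
  obtain ⟨σ, hσ, hσx⟩ := exists_signed_sqrt hs0 hx'
  obtain ⟨ρ, hρ, hρy⟩ := exists_signed_sqrt ht0 hy'
  refine ⟨r, ⟨⟨σ, ρ⟩, ?_⟩, ?_⟩
  · refine mem_sphere_zero_iff_norm.mpr ?_
    rw [← sq_eq_sq₀ (norm_nonneg _) zero_le_one, ← Complex.normSq_eq_norm_sq,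
      Complex.normSq_apply]
    linarith
  · funext i
    fin_cases i
    · simpa [circleParam, hσ, hρ] using hσx
    · simpa [circleParam, hσ, hρ] using hρy
    · simpa [circleParam] using hσ.symm
    · simpa [circleParam] using hρ.symm

lemma circleParam_fst_sq {a b c d : ℝ} (ha : 0 < a) (hb : 0 < b) (z : Circle) :
    circleParam a b c d z 0 ^ 2 = circleParam a b c d z 2 *
      (a * circleParam a b c d z 2 + b * circleParam a b c d z 3) := by
  have := pos_of_sq_add_sq_eq_one ha hb (Circle.re_sq_add_im_sq z)
  simp only [circleParam, Matrix.cons_val]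
  rw [mul_pow, Real.sq_sqrt this.le]

lemma circleParam_snd_sq {a b c d : ℝ} (hc : 0 < c) (hd : 0 < d) (z : Circle) :
    circleParam a b c d z 1 ^ 2 = circleParam a b c d z 3 *
      (c * circleParam a b c d z 2 + d * circleParam a b c d z 3) := by
  have := pos_of_sq_add_sq_eq_one hc hd (Circle.re_sq_add_im_sq z)
  simp only [circleParam, Matrix.cons_val]
  rw [mul_pow, Real.sq_sqrt this.le]

lemma Matrix.mulVec_ne_zero_of_det_ne_zero {P : Mat4} (hP : P.det ≠ 0) {w : Fin 4 → ℝ}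
    (hw : w ≠ 0) : P *ᵥ w ≠ 0 := fun h => hw (Matrix.eq_zero_of_mulVec_eq_zero hP h)

/-- A subset of projective space which in the coordinates `P` is given by
`x² = s (a s + b t)`, `y² = t (c s + d t)` with `a, b, c, d > 0` and `a d < b c` is a circle, and it
avoids the plane `s + t = 0`. -/
theorem curve_isCircle {a b c d : ℝ} (ha : 0 < a) (hb : 0 < b) (hc : 0 < c) (hd : 0 < d)
    (hbc : a * d < b * c) {P : Mat4} (hP : P.det ≠ 0) {S : Set RP3}
    (hS : ∀ w (hw : P *ᵥ w ≠ 0), Projectivization.mk ℝ (P *ᵥ w) hw ∈ S ↔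
      w 0 ^ 2 = w 2 * (a * w 2 + b * w 3) ∧ w 1 ^ 2 = w 3 * (c * w 2 + d * w 3)) :
    ∃ C : Set RP3, componentsOf S = {C} ∧ IsClosedComponent C ∧ Nonempty (C ≃ₜ Circle) := by
  have hne : ∀ z, P *ᵥ circleParam a b c d z ≠ 0 := fun z =>
    Matrix.mulVec_ne_zero_of_det_ne_zero hP (circleParam_ne_zero a b c d z)
  have hinjP : Function.Injective P.mulVec :=
    Matrix.mulVec_injective_of_isUnit ((Matrix.isUnit_iff_isUnit_det _).mpr hP.isUnit)
  have hunit : IsUnit P.det := hP.isUnit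
  let φ : Circle → RP3 := fun z => Projectivization.mk ℝ _ (hne z)
  have hφ : Continuous φ := RP3.continuous_mk
    (Continuous.matrix_mulVec continuous_const (continuous_circleParam a b c d)) hne
  have hinj : Function.Injective φ := by
    intro z w h
    obtain ⟨r, hr⟩ := (Projectivization.mk_eq_mk_iff' ℝ _ _ (hne z) (hne w)).mp h
    rw [← Matrix.mulVec_smul] at hr
    exact circleParam_injective ha hb hc hd (hinjP hr)
  have hrange : Set.range φ = S := by
    ext p
    constructor
    · rintro ⟨z, rfl⟩
      exact (hS _ _).mpr ⟨circleParam_fst_sq ha hb z, circleParam_snd_sq hc hd z⟩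
    · intro hp
      induction p using Projectivization.ind with | h v hv =>
      obtain ⟨w, rfl⟩ : ∃ w, P *ᵥ w = v :=
        ⟨P⁻¹ *ᵥ v, by rw [Matrix.mulVec_mulVec, Matrix.mul_nonsing_inv _ hunit,
          Matrix.one_mulVec]⟩
      obtain ⟨hx, hy⟩ := (hS w hv).mp hp
      have hw : w ≠ 0 := by rintro rfl; simp at hv
      obtain ⟨r, z, h⟩ := exists_circleParam ha hc hd hbc hw hx hy
      refine ⟨z, (Projectivization.mk_eq_mk_iff' ℝ _ _ _ _).mpr ⟨r, ?_⟩⟩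
      rw [← h, Matrix.mulVec_smul]
  have hconn : IsPreconnected S := by
    rw [← hrange, ← Set.image_univ]
    exact ((isConnected_univ (α := Circle)).image φ hφ.continuousOn).isPreconnected
  refine ⟨S, ?_, ?_, ?_⟩
  · have hSne : S.Nonempty := hrange ▸ Set.range_nonempty φ
    ext C
    simp only [componentsOf, Set.mem_ofPred_eq, Set.mem_singleton_iff]
    constructor
    · rintro ⟨p, hp, rfl⟩
      exact hconn.connectedComponentIn hp
    · rintro rfl
      obtain ⟨p, hp⟩ := hSne
      exact ⟨p, hp, (hconn.connectedComponentIn hp).symm⟩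
  · -- the plane `s + t = 0`
    intro hopen
    let n : Fin 4 → ℝ := ![0, 0, 1, 1] ᵥ* P⁻¹
    have hn : ∀ w, n ⬝ᵥ (P *ᵥ w) = w 2 + w 3 := by
      intro w
      rw [Matrix.dotProduct_mulVec, Matrix.vecMul_vecMul, Matrix.nonsing_inv_mul _ hunit,
        Matrix.vecMul_one]
      simp [dotProduct, Fin.sum_univ_four]
    have hn0 : n ≠ 0 := by
      intro h
      have h1 := hn ![0, 0, 1, 0]
      simp [h] at h1
    obtain ⟨p, hpS, hpn⟩ := hopen n hn0
    rw [← hrange] at hpS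
    obtain ⟨z, rfl⟩ := hpS
    obtain ⟨r, hr⟩ := Projectivization.exists_smul_eq_mk_rep ℝ _ (hne z)
    have hpn' : n ⬝ᵥ (φ z).rep = 0 := hpn
    have hr' : r • (P *ᵥ circleParam a b c d z) = (φ z).rep := hr
    rw [← hr', Units.smul_def, dotProduct_smul, hn, circleParam_sum] at hpn'
    simp at hpn'
  · subst hrange
    have hφ' : Continuous (Set.rangeFactorization φ) := hφ.subtype_mk _
    exact ⟨(Continuous.homeoOfEquivCompactToT2 (f := Equiv.ofInjective φ hinj) hφ').symm⟩

/-! ### Simultaneous block diagonalization of the pencil -/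

/-- The symmetric matrix with diagonal entries `a`, `b` and the trace-free `2 × 2` block
`[g, h; h, -g]`, i.e. the quadratic form `a x² + b y² + Re ((g - i h) (ξ + i η)²)`. -/
def blockForm (a b g h : ℝ) : Mat4 := !![a, 0, 0, 0; 0, b, 0, 0; 0, 0, g, h; 0, 0, h, -g]

lemma det_blockForm (a b g h : ℝ) : (blockForm a b g h).det = -(a * b * (g ^ 2 + h ^ 2)) := by
  rw [blockForm, Matrix.det_succ_row_zero]
  simp [Fin.sum_univ_four, Matrix.det_fin_three, Fin.succAbove]
  ring

lemma smul_sub_blockForm (μ a b g h a' b' g' h' : ℝ) :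
    μ • blockForm a b g h - blockForm a' b' g' h' =
      blockForm (μ * a - a') (μ * b - b') (μ * g - g') (μ * h - h') := by
  ext i j
  fin_cases i <;> fin_cases j <;> simp [blockForm]
  ring

lemma neg_blockForm (a b g h : ℝ) : -blockForm a b g h = blockForm (-a) (-b) (-g) (-h) := by
  ext i j
  fin_cases i <;> fin_cases j <;> simp [blockForm]

lemma blockForm_dotProduct (a b g h : ℝ) (w : Fin 4 → ℝ) :
    w ⬝ᵥ (blockForm a b g h *ᵥ w) =
      a * w 0 ^ 2 + b * w 1 ^ 2 + g * (w 2 ^ 2 - w 3 ^ 2) + 2 * h * (w 2 * w 3) := by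
  simp [blockForm, dotProduct, Matrix.mulVec, Fin.sum_univ_four]
  ring

/-- `A` and `B` are in normal form in the coordinates given by the columns of `P`: the first two
columns are eigenvectors of the pencil for the real roots `l₁ < l₂`, the last two are the real and
imaginary parts of an eigenvector for the root `p + i q`. -/
structure IsNormalForm (A B P : Mat4) (l₁ l₂ p q a₁ a₂ g h : ℝ) : Prop where
  det_ne_zero : P.det ≠ 0
  lt : l₁ < l₂
  im_ne_zero : q ≠ 0
  fst_ne_zero : a₁ ≠ 0
  snd_ne_zero : a₂ ≠ 0
  block_ne_zero : g ^ 2 + h ^ 2 ≠ 0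
  left : Pᵀ * A * P = blockForm a₁ a₂ g h
  right : Pᵀ * B * P = blockForm (l₁ * a₁) (l₂ * a₂) (p * g - q * h) (q * g + p * h)

lemma Matrix.IsSymm.dotProduct_mulVec_comm {A : Mat4} (hA : A.IsSymm) (v w : Fin 4 → ℝ) :
    v ⬝ᵥ (A *ᵥ w) = w ⬝ᵥ (A *ᵥ v) := by
  rw [Matrix.dotProduct_mulVec, ← Matrix.mulVec_transpose, hA.eq, dotProduct_comm]

/-- Eigenvectors of the pencil for distinct real roots are orthogonal. -/
lemma pencil_orthogonal {A B : Mat4} (hA : A.IsSymm) (hB : B.IsSymm) {l m : ℝ} (hlm : l ≠ m)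
    {v w : Fin 4 → ℝ} (hv : B *ᵥ v = l • (A *ᵥ v)) (hw : B *ᵥ w = m • (A *ᵥ w)) :
    v ⬝ᵥ (A *ᵥ w) = 0 := by
  have h := hB.dotProduct_mulVec_comm v w
  rw [hv, hw, dotProduct_smul, dotProduct_smul, hA.dotProduct_mulVec_comm w v] at h
  simp only [smul_eq_mul] at h
  exact (mul_eq_zero.mp (by linear_combination -h : (l - m) * (v ⬝ᵥ (A *ᵥ w)) = 0)).resolve_left
    (sub_ne_zero.mpr hlm)

/-- An eigenvector for a real root is orthogonal to the real and imaginary parts of an eigenvector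
for a non-real root `p + i q`. -/
lemma pencil_orthogonal_complex {A B : Mat4} (hA : A.IsSymm) (hB : B.IsSymm) {l p q : ℝ}
    (hq : q ≠ 0) {e u v : Fin 4 → ℝ} (he : B *ᵥ e = l • (A *ᵥ e))
    (hu : B *ᵥ u = p • (A *ᵥ u) - q • (A *ᵥ v)) (hv : B *ᵥ v = q • (A *ᵥ u) + p • (A *ᵥ v)) :
    e ⬝ᵥ (A *ᵥ u) = 0 ∧ e ⬝ᵥ (A *ᵥ v) = 0 := by
  have h1 := hB.dotProduct_mulVec_comm e u
  have h2 := hB.dotProduct_mulVec_comm e v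
  rw [he, hu, dotProduct_smul, dotProduct_sub, dotProduct_smul, dotProduct_smul,
    hA.dotProduct_mulVec_comm u e] at h1
  rw [he, hv, dotProduct_smul, dotProduct_add, dotProduct_smul, dotProduct_smul,
    hA.dotProduct_mulVec_comm v e] at h2
  simp only [smul_eq_mul] at h1 h2
  set x := e ⬝ᵥ (A *ᵥ u)
  set y := e ⬝ᵥ (A *ᵥ v)
  have hne : (p - l) ^ 2 + q ^ 2 ≠ 0 := by positivity
  constructor
  · exact (mul_eq_zero.mp (by linear_combination (p - l) * h1 + q * h2 :
      ((p - l) ^ 2 + q ^ 2) * x = 0)).resolve_left hne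
  · exact (mul_eq_zero.mp (by linear_combination (p - l) * h2 - q * h1 :
      ((p - l) ^ 2 + q ^ 2) * y = 0)).resolve_left hne

/-- An eigenvector for a non-real root is orthogonal to its complex conjugate. -/
lemma pencil_trace_free {A B : Mat4} (hA : A.IsSymm) (hB : B.IsSymm) {p q : ℝ}
    (hq : q ≠ 0) {u v : Fin 4 → ℝ}
    (hu : B *ᵥ u = p • (A *ᵥ u) - q • (A *ᵥ v)) (hv : B *ᵥ v = q • (A *ᵥ u) + p • (A *ᵥ v)) :
    v ⬝ᵥ (A *ᵥ v) = -(u ⬝ᵥ (A *ᵥ u)) := by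
  have h := hB.dotProduct_mulVec_comm u v
  rw [hu, hv, dotProduct_sub, dotProduct_add, dotProduct_smul, dotProduct_smul, dotProduct_smul,
    dotProduct_smul, hA.dotProduct_mulVec_comm v u] at h
  simp only [smul_eq_mul] at h
  exact mul_left_cancel₀ hq (by linear_combination h)

/-- The eigenvectors of the pencil for two distinct real roots, together with the real and imaginary
parts of an eigenvector for a non-real root, form a basis. -/
lemma det_eigenvectors_ne_zero {A B : Mat4} (hdet : A.det ≠ 0) {l₁ l₂ : ℝ} (hl : l₁ ≠ l₂)
    {z : ℂ} (hz : z.im ≠ 0) {e₁ e₂ u v : Fin 4 → ℝ} (he₁0 : e₁ ≠ 0) (he₂0 : e₂ ≠ 0)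
    (huv : u ≠ 0 ∨ v ≠ 0) (he₁ : B *ᵥ e₁ = l₁ • (A *ᵥ e₁)) (he₂ : B *ᵥ e₂ = l₂ • (A *ᵥ e₂))
    (hu : B *ᵥ u = z.re • (A *ᵥ u) - z.im • (A *ᵥ v))
    (hv : B *ᵥ v = z.im • (A *ᵥ u) + z.re • (A *ᵥ v)) :
    (Matrix.of ![e₁, e₂, u, v])ᵀ.det ≠ 0 := by
  have key : ∀ {x y : Fin 4 → ℝ}, B *ᵥ x = A *ᵥ y → (A⁻¹ * B) *ᵥ x = y := by
    intro x y h
    rw [← Matrix.mulVec_mulVec, h, Matrix.mulVec_mulVec, Matrix.nonsing_inv_mul _ hdet.isUnit,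
      Matrix.one_mulVec]
  set M := A⁻¹ * B
  have m₁ : M *ᵥ e₁ = l₁ • e₁ := key (by rw [he₁, Matrix.mulVec_smul])
  have m₂ : M *ᵥ e₂ = l₂ • e₂ := key (by rw [he₂, Matrix.mulVec_smul])
  have mu : M *ᵥ u = z.re • u - z.im • v := key (by
    rw [hu, Matrix.mulVec_sub, Matrix.mulVec_smul, Matrix.mulVec_smul])
  have mv : M *ᵥ v = z.im • u + z.re • v := key (by
    rw [hv, Matrix.mulVec_add, Matrix.mulVec_smul, Matrix.mulVec_smul])
  let f : Module.End ℂ (Fin 4 → ℂ) := Matrix.toLin' (M.map (fun a : ℝ => (a : ℂ)))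
  have hf : ∀ x y : Fin 4 → ℝ, f (fun i => (x i : ℂ) + y i * Complex.I) =
      fun i => (((M *ᵥ x) i : ℝ) : ℂ) + ((M *ᵥ y) i : ℝ) * Complex.I := by
    intro x y
    funext i
    simp only [f, Matrix.toLin'_apply, Matrix.mulVec, dotProduct, Matrix.map_apply]
    push_cast
    rw [Finset.sum_mul, ← Finset.sum_add_distrib]
    exact Finset.sum_congr rfl fun j _ => by ring
  let X : Fin 4 → Fin 4 → ℂ := ![fun i => (e₁ i : ℂ) + (0 : Fin 4 → ℝ) i * Complex.I,
    fun i => (e₂ i : ℂ) + (0 : Fin 4 → ℝ) i * Complex.I,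
    fun i => (u i : ℂ) + v i * Complex.I, fun i => (u i : ℂ) + (-v) i * Complex.I]
  let ev : Fin 4 → ℂ := ![l₁, l₂, z, (starRingEnd ℂ) z]
  have hev : Function.Injective ev := by
    have h1 : (l₁ : ℂ) ≠ l₂ := by exact_mod_cast hl
    have h2 : ∀ l : ℝ, (l : ℂ) ≠ z := fun l h => hz (by simp [← h])
    have h3 : ∀ l : ℝ, (l : ℂ) ≠ (starRingEnd ℂ) z := fun l h => hz (by
      have := congrArg Complex.im h
      simpa using this)
    have h4 : z ≠ (starRingEnd ℂ) z := fun h => hz (by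
      have := congrArg Complex.im h
      simp at this
      linarith)
    intro i j hij
    fin_cases i <;> fin_cases j <;>
      simp_all [ev, h1.symm, (h2 _).symm, (h3 _).symm, h4.symm]
  have hX : ∀ i, f.HasEigenvector (ev i) (X i) := by
    have real : ∀ (e : Fin 4 → ℝ) (l : ℝ), e ≠ 0 → M *ᵥ e = l • e →
        f.HasEigenvector (l : ℂ) (fun i => (e i : ℂ) + (0 : Fin 4 → ℝ) i * Complex.I) := by
      intro e l he hMe
      refine ⟨Module.End.mem_eigenspace_iff.mpr ?_, ?_⟩
      · rw [hf, hMe, Matrix.mulVec_zero]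
        funext i
        simp
      · intro h
        apply he
        funext i
        simpa using congrFun h i
    have cplx : ∀ x y : Fin 4 → ℝ, ∀ w : ℂ, (x ≠ 0 ∨ y ≠ 0) →
        M *ᵥ x = w.re • x - w.im • y → M *ᵥ y = w.im • x + w.re • y →
        f.HasEigenvector w (fun i => (x i : ℂ) + y i * Complex.I) := by
      intro x y w hxy hx hy
      refine ⟨Module.End.mem_eigenspace_iff.mpr ?_, ?_⟩
      · rw [hf, hx, hy]
        funext i
        apply Complex.ext <;> simp
        ring
      · intro h
        have hi := fun i => congrFun h i
        rcases hxy with h' | h' <;> apply h' <;> funext i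
        · simpa using congrArg Complex.re (hi i)
        · simpa using congrArg Complex.im (hi i)
    intro i
    fin_cases i
    · exact real e₁ l₁ he₁0 m₁
    · exact real e₂ l₂ he₂0 m₂
    · exact cplx u v z huv mu mv
    · refine cplx u (-v) _ (huv.imp id neg_ne_zero.mpr) ?_ ?_
      · simp [mu, ev]
      · rw [Matrix.mulVec_neg, mv]
        simp [ev]
        abel
  have hli := f.eigenvectors_linearIndependent' ev hev X hX
  intro h0
  obtain ⟨c, hc0, hc⟩ := Matrix.exists_mulVec_eq_zero_iff.mpr h0
  have hci : ∀ i, e₁ i * c 0 + e₂ i * c 1 + u i * c 2 + v i * c 3 = 0 := fun i => by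
    have := congrFun hc i
    simpa [Matrix.mulVec, dotProduct, Fin.sum_univ_four] using this
  -- `c₂ u + c₃ v` is the real part of `(c₂ - i c₃) (u + i v)`
  have hcoef := Fintype.linearIndependent_iff.mp hli
    ![(c 0 : ℂ), c 1, (c 2 - c 3 * Complex.I) / 2, (c 2 + c 3 * Complex.I) / 2] (by
      funext i
      have := hci i
      simp only [Fin.sum_univ_four, X]
      apply Complex.ext
      · simp
        linarith
      · simp
        ring)
  apply hc0
  have k0 := hcoef 0
  have k1 := hcoef 1
  have k2 := hcoef 2
  simp only [Matrix.cons_val] at k0 k1 k2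
  have k2r := congrArg Complex.re k2
  have k2i := congrArg Complex.im k2
  funext i
  fin_cases i
  · simpa using k0
  · simpa using k1
  · simpa using k2r
  · simpa using k2i

lemma transpose_mul_mul_apply (D : Mat4) (X : Fin 4 → Fin 4 → ℝ) (i j : Fin 4) :
    ((Matrix.of X)ᵀᵀ * D * (Matrix.of X)ᵀ) i j = X i ⬝ᵥ (D *ᵥ X j) := by
  rw [Matrix.mul_assoc]
  simp only [Matrix.mul_apply, dotProduct, Matrix.mulVec, Matrix.transpose_apply, Matrix.of_apply]

/-- A vector in the kernel of `l A - B`. -/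
lemma exists_pencil_eigenvector {A B : Mat4} {l : ℝ} (h : (l • A - B).det = 0) :
    ∃ e : Fin 4 → ℝ, e ≠ 0 ∧ B *ᵥ e = l • (A *ᵥ e) := by
  obtain ⟨e, he0, he⟩ := Matrix.exists_mulVec_eq_zero_iff.mpr h
  rw [Matrix.sub_mulVec, Matrix.smul_mulVec, sub_eq_zero] at he
  exact ⟨e, he0, he.symm⟩

/-- The real and imaginary parts of a complex vector in the kernel of `z A - B`. -/
lemma exists_pencil_complex_eigenvector {A B : Mat4} {z : ℂ}
    (h : (z • A.map (fun a : ℝ => (a : ℂ)) - B.map (fun b : ℝ => (b : ℂ))).det = 0) :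
    ∃ u v : Fin 4 → ℝ, (u ≠ 0 ∨ v ≠ 0) ∧ B *ᵥ u = z.re • (A *ᵥ u) - z.im • (A *ᵥ v) ∧
      B *ᵥ v = z.im • (A *ᵥ u) + z.re • (A *ᵥ v) := by
  obtain ⟨e, he0, he⟩ := Matrix.exists_mulVec_eq_zero_iff.mpr h
  rw [Matrix.sub_mulVec, Matrix.smul_mulVec, sub_eq_zero] at he
  have hre : ∀ (D : Mat4) i, ((D.map (fun a : ℝ => (a : ℂ)) *ᵥ e) i).re =
      (D *ᵥ fun k => (e k).re) i := fun D i => by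
    simp [Matrix.mulVec, dotProduct]
  have him : ∀ (D : Mat4) i, ((D.map (fun a : ℝ => (a : ℂ)) *ᵥ e) i).im =
      (D *ᵥ fun k => (e k).im) i := fun D i => by
    simp [Matrix.mulVec, dotProduct]
  refine ⟨fun k => (e k).re, fun k => (e k).im, ?_, ?_, ?_⟩
  · by_contra! hcon
    apply he0
    funext k
    exact Complex.ext (congrFun hcon.1 k) (congrFun hcon.2 k)
  · funext i
    have := congrArg Complex.re (congrFun he i)
    simp only [Pi.smul_apply, smul_eq_mul, Complex.mul_re, hre, him] at this
    simp [← this]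
  · funext i
    have := congrArg Complex.im (congrFun he i)
    simp only [Pi.smul_apply, smul_eq_mul, Complex.mul_im, hre, him] at this
    simp [← this]
    ring

/-- A nonsingular pencil with two real roots and a non-real one can be brought into normal form. -/
theorem exists_normalForm {A B : Mat4} (hA : A.IsSymm) (hB : B.IsSymm) (hdet : A.det ≠ 0)
    {l₁ l₂ : ℝ} (hl : l₁ < l₂) (h₁ : (l₁ • A - B).det = 0) (h₂ : (l₂ • A - B).det = 0) {z : ℂ}
    (hz : z.im ≠ 0)
    (hzdet : (z • A.map (fun a : ℝ => (a : ℂ)) - B.map (fun b : ℝ => (b : ℂ))).det = 0) :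
    ∃ P a₁ a₂ g h, IsNormalForm A B P l₁ l₂ z.re z.im a₁ a₂ g h := by
  obtain ⟨e₁, he₁0, he₁⟩ := exists_pencil_eigenvector h₁
  obtain ⟨e₂, he₂0, he₂⟩ := exists_pencil_eigenvector h₂
  obtain ⟨u, v, huv, hu, hv⟩ := exists_pencil_complex_eigenvector hzdet
  have hP := det_eigenvectors_ne_zero hdet hl.ne hz he₁0 he₂0 huv he₁ he₂ hu hv
  have o12 := pencil_orthogonal hA hB hl.ne he₁ he₂
  obtain ⟨o1u, o1v⟩ := pencil_orthogonal_complex hA hB hz he₁ hu hv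
  obtain ⟨o2u, o2v⟩ := pencil_orthogonal_complex hA hB hz he₂ hu hv
  have ovv := pencil_trace_free hA hB hz hu hv
  have o21 := o12; rw [hA.dotProduct_mulVec_comm] at o21
  have ou1 := o1u; rw [hA.dotProduct_mulVec_comm] at ou1
  have ov1 := o1v; rw [hA.dotProduct_mulVec_comm] at ov1
  have ou2 := o2u; rw [hA.dotProduct_mulVec_comm] at ou2
  have ov2 := o2v; rw [hA.dotProduct_mulVec_comm] at ov2
  have ovu := hA.dotProduct_mulVec_comm v u
  have hleft : (Matrix.of ![e₁, e₂, u, v])ᵀᵀ * A * (Matrix.of ![e₁, e₂, u, v])ᵀ =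
      blockForm (e₁ ⬝ᵥ (A *ᵥ e₁)) (e₂ ⬝ᵥ (A *ᵥ e₂)) (u ⬝ᵥ (A *ᵥ u)) (u ⬝ᵥ (A *ᵥ v)) := by
    ext i j
    rw [transpose_mul_mul_apply]
    fin_cases i <;> fin_cases j <;>
      simp [blockForm, o12, o21, o1u, o1v, o2u, o2v, ou1, ov1, ou2, ov2, ovu, ovv]
  have hdet' := congrArg Matrix.det hleft
  rw [det_blockForm, Matrix.det_mul, Matrix.det_mul, Matrix.det_transpose] at hdet'
  have hne : (e₁ ⬝ᵥ (A *ᵥ e₁)) * (e₂ ⬝ᵥ (A *ᵥ e₂)) *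
      ((u ⬝ᵥ (A *ᵥ u)) ^ 2 + (u ⬝ᵥ (A *ᵥ v)) ^ 2) ≠ 0 := by
    intro h0
    rw [h0, neg_zero] at hdet'
    exact mul_ne_zero (mul_ne_zero hP hdet) hP hdet'
  refine ⟨_, _, _, _, _, hP, hl, hz, left_ne_zero_of_mul (left_ne_zero_of_mul hne),
    right_ne_zero_of_mul (left_ne_zero_of_mul hne), right_ne_zero_of_mul hne, hleft, ?_⟩
  ext i j
  rw [transpose_mul_mul_apply]
  fin_cases i <;> fin_cases j <;>
    simp [blockForm, o12, o21, o1u, o1v, o2u, o2v, ou1, ov1, ou2, ov2, ovu, ovv, he₁, he₂, hu, hv] <;>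
    ring

/-! ### The index sequence of a pencil in normal form -/

/-- Multiplication of `ξ + i η` by `r + i s` in the last two coordinates `(ξ, η)`, the identity in the
first two. -/
def complexScaling (r s : ℝ) : Mat4 := !![1, 0, 0, 0; 0, 1, 0, 0; 0, 0, r, -s; 0, 0, s, r]

lemma det_complexScaling (r s : ℝ) : (complexScaling r s).det = r ^ 2 + s ^ 2 := by
  rw [complexScaling, Matrix.det_succ_row_zero]
  simp [Fin.sum_univ_four, Matrix.det_fin_three, Fin.succAbove]
  ring

lemma complexScaling_congr (a b g h r s : ℝ) :
    (complexScaling r s)ᵀ * blockForm a b g h * complexScaling r s =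
      blockForm a b (g * (r ^ 2 - s ^ 2) + 2 * h * r * s)
        (h * (r ^ 2 - s ^ 2) - 2 * g * r * s) := by
  ext i j
  fin_cases i <;> fin_cases j <;>
    simp [complexScaling, blockForm, Matrix.mul_apply, Fin.sum_univ_four] <;> ring

/-- **Sylvester's law of inertia** for a matrix that is congruent to a diagonal one. -/
lemma matIndex_of_congr_diagonal {D P : Mat4} (hP : P.det ≠ 0) {w : Fin 4 → ℝ}
    (h : Pᵀ * D * P = Matrix.diagonal w) : matIndex D = {i | 0 < w i}.ncard := by
  refine QuadraticForm.sigPos_of_equiv_weightedSumSquares (QuadraticMap.Equivalent.symm ⟨?_⟩)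
  have hinj : Function.Injective P.mulVecLin :=
    Matrix.mulVec_injective_of_isUnit ((Matrix.isUnit_iff_isUnit_det _).mpr hP.isUnit)
  refine ⟨LinearEquiv.ofInjectiveEndo P.mulVecLin hinj, fun m => ?_⟩
  have h1 : D.toQuadraticForm' (P *ᵥ m) = (P *ᵥ m) ⬝ᵥ (D *ᵥ (P *ᵥ m)) := by
    simp [Matrix.toQuadraticForm', Matrix.toLinearMap₂'_apply']
  have h2 : (P *ᵥ m) ⬝ᵥ (D *ᵥ (P *ᵥ m)) = m ⬝ᵥ ((Pᵀ * D * P) *ᵥ m) := by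
    rw [Matrix.mul_assoc, ← Matrix.mulVec_mulVec, Matrix.dotProduct_mulVec m,
      Matrix.vecMul_transpose, Matrix.mulVec_mulVec]
  refine (h1.trans h2).trans ?_
  rw [h, QuadraticMap.weightedSumSquares_apply]
  simp only [dotProduct, Matrix.mulVec_diagonal, smul_eq_mul]
  exact Finset.sum_congr rfl fun i _ => by ring

/-- A trace-free nonsingular `2 × 2` block has exactly one positive square. -/
lemma matIndex_of_congr {D P : Mat4} (hP : P.det ≠ 0) {a b g h : ℝ} (hgh : g ^ 2 + h ^ 2 ≠ 0)
    (hD : Pᵀ * D * P = blockForm a b g h) :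
    matIndex D = (if 0 < a then 1 else 0) + (if 0 < b then 1 else 0) + 1 := by
  -- a square root of `g + i h` rotates the block into diagonal form
  obtain ⟨κ, hκ'⟩ := IsAlgClosed.exists_pow_nat_eq (⟨g, h⟩ : ℂ) two_pos
  have hκ := hκ'.symm
  have hre : g = κ.re ^ 2 - κ.im ^ 2 := by
    have := congrArg Complex.re hκ
    simpa [sq] using this
  have him : h = 2 * κ.re * κ.im := by
    have := congrArg Complex.im hκ
    simp [sq] at this
    linarith
  have hN : 0 < g ^ 2 + h ^ 2 := lt_of_le_of_ne (by positivity) hgh.symm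
  have hR : (complexScaling κ.re κ.im).det ≠ 0 := by
    rw [det_complexScaling]
    intro h0
    have h1 : κ.re = 0 := by nlinarith [sq_nonneg κ.re, sq_nonneg κ.im]
    have h2 : κ.im = 0 := by nlinarith [sq_nonneg κ.re, sq_nonneg κ.im]
    apply hgh
    rw [hre, him, h1, h2]
    ring
  have key : (P * complexScaling κ.re κ.im)ᵀ * D * (P * complexScaling κ.re κ.im) =
      Matrix.diagonal ![a, b, g ^ 2 + h ^ 2, -(g ^ 2 + h ^ 2)] := by
    have : (P * complexScaling κ.re κ.im)ᵀ * D * (P * complexScaling κ.re κ.im) =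
        (complexScaling κ.re κ.im)ᵀ * (Pᵀ * D * P) * complexScaling κ.re κ.im := by
      simp only [Matrix.transpose_mul, Matrix.mul_assoc]
    rw [this, hD, complexScaling_congr, mul_assoc 2 h, mul_assoc 2 g, ← mul_assoc 2 g]
    have e1 : g * (κ.re ^ 2 - κ.im ^ 2) + 2 * (h * κ.re) * κ.im = g ^ 2 + h ^ 2 := by
      rw [← hre]; rw [him]; ring
    have e2 : h * (κ.re ^ 2 - κ.im ^ 2) - 2 * g * κ.re * κ.im = 0 := by
      rw [← hre]; rw [him]; ring
    ext i j
    fin_cases i <;> fin_cases j <;> simp [blockForm, Matrix.diagonal] <;> linarith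
  rw [matIndex_of_congr_diagonal (by rw [Matrix.det_mul]; exact mul_ne_zero hP hR) key,
    Set.ncard_eq_toFinset_card', Set.toFinset_ofPred, Finset.card_filter, Fin.sum_univ_four]
  simp [hN]
  linarith

namespace IsNormalForm

variable {A B P : Mat4} {l₁ l₂ p q a₁ a₂ g h : ℝ}

lemma congr_smul_sub (N : IsNormalForm A B P l₁ l₂ p q a₁ a₂ g h) (μ : ℝ) :
    Pᵀ * (μ • A - B) * P = blockForm ((μ - l₁) * a₁) ((μ - l₂) * a₂)
      ((μ - p) * g + q * h) ((μ - p) * h - q * g) := by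
  rw [Matrix.mul_sub, Matrix.sub_mul, Matrix.mul_smul, Matrix.smul_mul, N.left, N.right,
    smul_sub_blockForm]
  congr 1 <;> ring

lemma block_smul_sub_ne_zero (N : IsNormalForm A B P l₁ l₂ p q a₁ a₂ g h) (μ : ℝ) :
    ((μ - p) * g + q * h) ^ 2 + ((μ - p) * h - q * g) ^ 2 ≠ 0 := by
  have hq := N.im_ne_zero
  have : ((μ - p) * g + q * h) ^ 2 + ((μ - p) * h - q * g) ^ 2 =
    ((μ - p) ^ 2 + q ^ 2) * (g ^ 2 + h ^ 2) := by ring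
  rw [this]
  exact mul_ne_zero (by positivity) N.block_ne_zero

lemma matIndex_smul_sub (N : IsNormalForm A B P l₁ l₂ p q a₁ a₂ g h) (μ : ℝ) :
    matIndex (μ • A - B) = (if 0 < (μ - l₁) * a₁ then 1 else 0) +
      (if 0 < (μ - l₂) * a₂ then 1 else 0) + 1 :=
  matIndex_of_congr N.det_ne_zero (N.block_smul_sub_ne_zero μ) (N.congr_smul_sub μ)

lemma matIndex_neg_smul_sub (N : IsNormalForm A B P l₁ l₂ p q a₁ a₂ g h) (μ : ℝ) :
    matIndex (-(μ • A - B)) = (if 0 < -((μ - l₁) * a₁) then 1 else 0) +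
      (if 0 < -((μ - l₂) * a₂) then 1 else 0) + 1 :=
  matIndex_of_congr N.det_ne_zero (g := -((μ - p) * g + q * h))
    (h := -((μ - p) * h - q * g)) (by simpa only [neg_sq] using N.block_smul_sub_ne_zero μ)
    (by rw [Matrix.mul_neg, Matrix.neg_mul, N.congr_smul_sub, neg_blockForm])

lemma matIndex_left (N : IsNormalForm A B P l₁ l₂ p q a₁ a₂ g h) :
    matIndex A = (if 0 < a₁ then 1 else 0) + (if 0 < a₂ then 1 else 0) + 1 :=
  matIndex_of_congr N.det_ne_zero N.block_ne_zero N.left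

lemma matIndex_neg_left (N : IsNormalForm A B P l₁ l₂ p q a₁ a₂ g h) :
    matIndex (-A) = (if 0 < -a₁ then 1 else 0) + (if 0 < -a₂ then 1 else 0) + 1 :=
  matIndex_of_congr N.det_ne_zero (g := -g) (h := -h)
    (by simpa only [neg_sq] using N.block_ne_zero)
    (by rw [Matrix.mul_neg, Matrix.neg_mul, N.left, neg_blockForm])

/-- The characteristic polynomial, up to a nonzero factor. -/
lemma exists_det_eq (N : IsNormalForm A B P l₁ l₂ p q a₁ a₂ g h) :
    ∃ k ≠ 0, ∀ μ : ℝ,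
      (μ • A - B).det = k * ((μ - l₁) * (μ - l₂) * ((μ - p) ^ 2 + q ^ 2)) := by
  have hP := N.det_ne_zero
  refine ⟨-(a₁ * a₂ * (g ^ 2 + h ^ 2)) / P.det ^ 2, div_ne_zero (neg_ne_zero.mpr
    (mul_ne_zero (mul_ne_zero N.fst_ne_zero N.snd_ne_zero) N.block_ne_zero)) (by positivity),
    fun μ => ?_⟩
  have hdet := congrArg Matrix.det (N.congr_smul_sub μ)
  rw [Matrix.det_mul, Matrix.det_mul, Matrix.det_transpose, det_blockForm] at hdet
  field_simp
  linear_combination hdet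

lemma det_smul_sub_eq_zero_iff (N : IsNormalForm A B P l₁ l₂ p q a₁ a₂ g h) (μ : ℝ) :
    (μ • A - B).det = 0 ↔ μ = l₁ ∨ μ = l₂ := by
  obtain ⟨k, hk, hdet⟩ := N.exists_det_eq
  have hq := N.im_ne_zero
  have : (μ - p) ^ 2 + q ^ 2 ≠ 0 := by positivity
  simp [hdet, hk, this, sub_eq_zero]

/-- The real roots are simple roots of the characteristic polynomial of `A⁻¹ B`, so that their
generalized eigenspaces are lines. -/
lemma finrank_maxGenEigenspace (N : IsNormalForm A B P l₁ l₂ p q a₁ a₂ g h) (hA : A.det ≠ 0)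
    {l : ℝ} (hl : l = l₁ ∨ l = l₂) :
    Module.finrank ℝ (Module.End.maxGenEigenspace (Matrix.toLin' (A⁻¹ * B)) l) = 1 := by
  obtain ⟨k, hk, hdet⟩ := N.exists_det_eq
  have hq := N.im_ne_zero
  have hlt := N.lt
  obtain ⟨m, hm, hprod⟩ : ∃ m, l ≠ m ∧ ∀ μ, (μ - l₁) * (μ - l₂) = (μ - l) * (μ - m) := by
    rcases hl with rfl | rfl
    · exact ⟨l₂, hlt.ne, fun μ => rfl⟩
    · exact ⟨l₁, hlt.ne', fun μ => mul_comm _ _⟩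
  open Polynomial in
  have hchar : (A⁻¹ * B).charpoly =
      (X - C l) * (C (k / A.det) * (X - C m) * ((X - C p) ^ 2 + C (q ^ 2))) := by
    refine Polynomial.funext fun μ => ?_
    have h1 : A * (Matrix.scalar (Fin 4) μ - A⁻¹ * B) = μ • A - B := by
      rw [Matrix.mul_sub, ← Matrix.mul_assoc, Matrix.mul_nonsing_inv _ hA.isUnit, Matrix.one_mul,
        Matrix.scalar_apply, ← Matrix.smul_one_eq_diagonal, Matrix.mul_smul, Matrix.mul_one]
    have h2 := congrArg Matrix.det h1
    rw [Matrix.det_mul, hdet, hprod] at h2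
    rw [Matrix.eval_charpoly]
    simp only [eval_mul, eval_sub, eval_X, eval_C, eval_add, eval_pow]
    field_simp
    linear_combination h2
  have hne : (A⁻¹ * B).charpoly ≠ 0 := (Matrix.charpoly_monic _).ne_zero
  rw [LinearMap.finrank_maxGenEigenspace_eq, Matrix.charpoly_toLin']
  rw [hchar] at hne ⊢
  rw [Polynomial.rootMultiplicity_mul hne, Polynomial.rootMultiplicity_X_sub_C_self,
    Polynomial.rootMultiplicity_eq_zero]
  have h1 : (l - p) ^ 2 + q ^ 2 ≠ 0 := by positivity
  simp [Polynomial.IsRoot, hk, hA, sub_eq_zero, hm, h1]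

/-- The index sequence of a pencil in normal form; it is determined by the signs of `a₁`, `a₂`. -/
theorem hasBarIndexSequence (N : IsNormalForm A B P l₁ l₂ p q a₁ a₂ g h) (hA : A.det ≠ 0) :
    ∃ s, HasBarIndexSequence A B s ∧ s.getLast? = some (matIndex A) ∧
      (s = [1, 2, 3] ∨ s = [2, 3, 2] ∨ s = [2, 1, 2] ∨ s = [3, 2, 1]) := by
  have hlt := N.lt
  let t : Fin 3 → ℕ := ![matIndex (-A),
    (if 0 < a₁ then 1 else 0) + (if 0 < -a₂ then 1 else 0) + 1, matIndex A]
  refine ⟨List.ofFn t, ⟨hA, 2, ![l₁, l₂], t, ?_, ?_, ?_, rfl, rfl, ?_, rfl⟩, ?_, ?_⟩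
  · intro i j hij
    fin_cases i <;> fin_cases j <;> simp_all
  · ext x
    simp only [Matrix.range_cons, Matrix.range_empty, Set.union_empty]
    simp [N.det_smul_sub_eq_zero_iff, or_comm]
  · intro j
    fin_cases j
    · exact N.finrank_maxGenEigenspace hA (Or.inl rfl)
    · exact N.finrank_maxGenEigenspace hA (Or.inr rfl)
  · intro i j hij μ hμ
    obtain ⟨rfl, rfl⟩ : i = 0 ∧ j = 1 := by omega
    have h1 : l₁ < μ := hμ.1
    have h2 : μ < l₂ := hμ.2
    rw [N.matIndex_smul_sub]
    have : 0 < (μ - l₂) * a₂ ↔ 0 < -a₂ := by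
      rw [show (μ - l₂) * a₂ = (l₂ - μ) * (-a₂) by ring,
        mul_pos_iff_of_pos_left (sub_pos.mpr h2)]
    simp only [this, mul_pos_iff_of_pos_left (sub_pos.mpr h1)]
    rfl
  · simp [t]
  · have ha₁ := N.fst_ne_zero
    have ha₂ := N.snd_ne_zero
    simp only [t, N.matIndex_left, N.matIndex_neg_left]
    rcases lt_or_gt_of_ne ha₁ with h1 | h1 <;> rcases lt_or_gt_of_ne ha₂ with h2 | h2 <;>
      simp [h1, h2, h1.le, h2.le, not_lt.mpr]

end IsNormalForm

lemma indexSeqEquiv_one_two_three {s : List ℕ}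
    (hs : s = [1, 2, 3] ∨ s = [2, 3, 2] ∨ s = [2, 1, 2] ∨ s = [3, 2, 1]) :
    IndexSeqEquiv s [1, 2, 3] := by
  have adm : ∀ a b c : ℕ, a ≤ 4 → b ≤ 4 → c ≤ 4 → a + c = 4 → IsAdmissibleSeq [a, b, c] := by
    intro a b c ha hb hc h
    refine ⟨by simp [ha, hb, hc], by simp, by simpa using h⟩
  have h1 : IndexSeqEquiv [2, 3, 2] [1, 2, 3] := .rel _ _
    (IndexSeqMove.rotateRight [2] 3 2 (adm 2 3 2 (by simp) (by simp) (by simp) (by simp)))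
  have h2 : IndexSeqEquiv [2, 1, 2] [2, 3, 2] := .rel _ _
    (IndexSeqMove.complement [2, 1, 2] (adm 2 1 2 (by simp) (by simp) (by simp) (by simp)))
  have h3 : IndexSeqEquiv [3, 2, 1] [1, 2, 3] := .rel _ _
    (IndexSeqMove.reversal [3, 2, 1] (adm 3 2 1 (by simp) (by simp) (by simp) (by simp)))
  rcases hs with rfl | rfl | rfl | rfl
  · exact .refl _
  · exact h1
  · exact h2.trans _ _ _ h1
  · exact h3

/-! ### The intersection curve of a pencil in normal form -/

/-- If `(n + i m)² = 2 H + 2 i G`, then `G (ξ² - η²) + 2 H ξ η = (m ξ + n η) (n ξ - m η)`.  The forms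
`ξ² - η² = (ξ - η) (ξ + η)` and this one are both nonnegative exactly on the double wedge bounded by
`ξ = η` and `m ξ + n η = 0`; the new coordinates `s`, `t` vanish on these two lines. -/
lemma exists_wedge_coordinates_of_pos (G : ℝ) {H : ℝ} (hH : 0 < H) :
    ∃ α β γ δ a b c d : ℝ, α * δ - β * γ ≠ 0 ∧ 0 < a ∧ 0 < b ∧ 0 < c ∧ 0 < d ∧ a * d < b * c ∧
      ∀ s t : ℝ,
        (α * s + β * t) ^ 2 - (γ * s + δ * t) ^ 2 = s * (a * s + b * t) ∧
        G * ((α * s + β * t) ^ 2 - (γ * s + δ * t) ^ 2) +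
          2 * H * ((α * s + β * t) * (γ * s + δ * t)) = t * (c * s + d * t) := by
  obtain ⟨n, m, hn, hre, him⟩ : ∃ n m : ℝ, 0 < n ∧ n ^ 2 - m ^ 2 = 2 * H ∧ n * m = G := by
    obtain ⟨κ, hκ⟩ := IsAlgClosed.exists_pow_nat_eq (⟨2 * H, 2 * G⟩ : ℂ) two_pos
    have hre : κ.re ^ 2 - κ.im ^ 2 = 2 * H := by
      have := congrArg Complex.re hκ
      simpa [sq] using this
    have him : κ.re * κ.im = G := by
      have := congrArg Complex.im hκ
      simp [sq] at this
      linarith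
    have h0 : κ.re ≠ 0 := by
      intro h
      rw [h] at hre
      nlinarith [sq_nonneg κ.im]
    rcases lt_or_gt_of_ne h0 with h | h
    · exact ⟨-κ.re, -κ.im, by linarith, by rw [neg_sq, neg_sq, hre], by rw [neg_mul_neg, him]⟩
    · exact ⟨κ.re, κ.im, h, hre, him⟩
  obtain ⟨h1, h2⟩ : -n < m ∧ m < n := abs_lt.mp (abs_lt_of_sq_lt_sq (by linarith) hn.le)
  have hp : 0 < n + m := by linarith
  have hm : 0 < n - m := by linarith
  refine ⟨n, 1, -m, 1, (n + m) * (n - m), 2 * (n + m), (n + m) * (n ^ 2 + m ^ 2),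
    (n + m) * (n - m), by linarith, by positivity, by positivity, by positivity, by positivity,
    ?_, fun s t => ⟨by ring, ?_⟩⟩
  · have : 0 < (n + m) ^ 2 * (n + m) ^ 2 := by positivity
    linarith
  · rw [← him, ← hre]
    ring

/-- Two linearly independent trace-free binary quadratic forms are brought into the form
`s (a s + b t)`, `t (c s + d t)` by a linear change of coordinates. -/
lemma exists_wedge_coordinates {G H G' H' : ℝ} (hne : G * H' - G' * H ≠ 0) :
    ∃ α β γ δ a b c d : ℝ, α * δ - β * γ ≠ 0 ∧ 0 < a ∧ 0 < b ∧ 0 < c ∧ 0 < d ∧ a * d < b * c ∧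
      ∀ s t : ℝ,
        G * ((α * s + β * t) ^ 2 - (γ * s + δ * t) ^ 2) +
          2 * H * ((α * s + β * t) * (γ * s + δ * t)) = s * (a * s + b * t) ∧
        G' * ((α * s + β * t) ^ 2 - (γ * s + δ * t) ^ 2) +
          2 * H' * ((α * s + β * t) * (γ * s + δ * t)) = t * (c * s + d * t) := by
  have hGH : G ^ 2 + H ^ 2 ≠ 0 := by
    intro h
    have h1 : G = 0 := by nlinarith [sq_nonneg G, sq_nonneg H]
    have h2 : H = 0 := by nlinarith [sq_nonneg G, sq_nonneg H]
    simp [h1, h2] at hne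
  -- the substitution `ω = (r + i s) ω'` turns the first form `Re ((G - i H) ω²)` into `Re (ω'²)`
  obtain ⟨κ, hκ⟩ := IsAlgClosed.exists_pow_nat_eq
    (⟨G / (G ^ 2 + H ^ 2), H / (G ^ 2 + H ^ 2)⟩ : ℂ) two_pos
  set r := κ.re
  set i := κ.im
  have hre : (G ^ 2 + H ^ 2) * (r ^ 2 - i ^ 2) = G := by
    have := congrArg Complex.re hκ
    simp only [sq κ, Complex.mul_re] at this
    field_simp at this
    linarith
  have him : (G ^ 2 + H ^ 2) * (2 * r * i) = H := by
    have := congrArg Complex.im hκ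
    simp only [sq κ, Complex.mul_im] at this
    field_simp at this
    linarith
  have e1 : G * (r ^ 2 - i ^ 2) + H * (2 * r * i) = 1 :=
    mul_left_cancel₀ hGH (by linear_combination G * hre + H * him)
  have e2 : H * (r ^ 2 - i ^ 2) - G * (2 * r * i) = 0 :=
    mul_left_cancel₀ hGH (by linear_combination H * hre - G * him)
  set K := H' * (r ^ 2 - i ^ 2) - G' * (2 * r * i) with hK
  set F := G' * (r ^ 2 - i ^ 2) + H' * (2 * r * i) with hF
  have hK0 : K ≠ 0 := by
    intro h0
    apply hne
    linear_combination (G ^ 2 + H ^ 2) * h0 - H' * hre + G' * him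
  have hri : r ^ 2 + i ^ 2 ≠ 0 := by
    intro h
    have h1 : r = 0 := by nlinarith [sq_nonneg r, sq_nonneg i]
    have h2 : i = 0 := by nlinarith [sq_nonneg r, sq_nonneg i]
    simp [h1, h2] at e1
  -- the sign of `K` is changed by the reflection `η' ↦ -η'`
  obtain ⟨ε, hε, hεK⟩ : ∃ ε : ℝ, ε ^ 2 = 1 ∧ 0 < ε * K := by
    rcases lt_or_gt_of_ne hK0 with h | h
    · exact ⟨-1, by norm_num, by linarith⟩
    · exact ⟨1, by norm_num, by linarith⟩
  have hε0 : ε ≠ 0 := by rintro rfl; norm_num at hε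
  obtain ⟨α, β, γ, δ, a, b, c, d, hdet, ha, hb, hc, hd, hlt, hform⟩ :=
    exists_wedge_coordinates_of_pos F hεK
  refine ⟨r * α - i * (ε * γ), r * β - i * (ε * δ), i * α + r * (ε * γ), i * β + r * (ε * δ),
    a, b, c, d, ?_, ha, hb, hc, hd, hlt, fun s t => ?_⟩
  · have : (r * α - i * (ε * γ)) * (i * β + r * (ε * δ)) -
        (r * β - i * (ε * δ)) * (i * α + r * (ε * γ)) =
        (r ^ 2 + i ^ 2) * ε * (α * δ - β * γ) := by ring
    rw [this]
    exact mul_ne_zero (mul_ne_zero hri hε0) hdet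
  · obtain ⟨h1, h2⟩ := hform s t
    set x := α * s + β * t
    set y := γ * s + δ * t
    have hx : (r * α - i * (ε * γ)) * s + (r * β - i * (ε * δ)) * t = r * x - i * (ε * y) := by
      ring
    have hy : (i * α + r * (ε * γ)) * s + (i * β + r * (ε * δ)) * t = i * x + r * (ε * y) := by
      ring
    rw [hx, hy, ← h1, ← h2, hF, hK]
    constructor
    · linear_combination (x ^ 2 - (ε * y) ^ 2) * e1 + 2 * x * (ε * y) * e2 - y ^ 2 * hε
    · linear_combination (-(G' * (r ^ 2 - i ^ 2) + H' * (2 * r * i)) * y ^ 2) * hε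

lemma mem_quadric_mk (D : Mat4) {v : Fin 4 → ℝ} (hv : v ≠ 0) :
    Projectivization.mk ℝ v hv ∈ quadric D ↔ v ⬝ᵥ (D *ᵥ v) = 0 := by
  obtain ⟨r, hr⟩ := Projectivization.exists_smul_eq_mk_rep ℝ v hv
  have h : (Projectivization.mk ℝ v hv).rep = (r : ℝ) • v := hr.symm
  change (Projectivization.mk ℝ v hv).rep ⬝ᵥ (D *ᵥ (Projectivization.mk ℝ v hv).rep) = 0 ↔ _
  rw [h, Matrix.mulVec_smul, dotProduct_smul, smul_dotProduct]
  simp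

/-- The intersection curve depends only on the pencil. -/
lemma qsic_eq_of_generatesSamePencil {A B A' B' : Mat4} (h : GeneratesSamePencil A B A' B') :
    qsic A' B' = qsic A B := by
  obtain ⟨a, b, c, d, hdet, rfl, rfl⟩ := h
  ext p
  induction p using Projectivization.ind with | h v hv =>
  simp only [qsic, Set.mem_inter_iff, mem_quadric_mk, Matrix.add_mulVec, Matrix.smul_mulVec,
    dotProduct_add, dotProduct_smul, smul_eq_mul]
  constructor
  · rintro ⟨h1, h2⟩
    exact ⟨(mul_eq_zero.mp (by linear_combination d * h1 - b * h2 :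
        (a * d - b * c) * (v ⬝ᵥ (A *ᵥ v)) = 0)).resolve_left hdet,
      (mul_eq_zero.mp (by linear_combination a * h2 - c * h1 :
        (a * d - b * c) * (v ⬝ᵥ (B *ᵥ v)) = 0)).resolve_left hdet⟩
  · rintro ⟨h1, h2⟩
    simp [h1, h2]

/-- A linear change of the last two coordinates. -/
def lastTwoChange (α β γ δ : ℝ) : Mat4 := !![1, 0, 0, 0; 0, 1, 0, 0; 0, 0, α, β; 0, 0, γ, δ]

lemma det_lastTwoChange (α β γ δ : ℝ) : (lastTwoChange α β γ δ).det = α * δ - β * γ := by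
  rw [lastTwoChange, Matrix.det_succ_row_zero]
  simp [Fin.sum_univ_four, Matrix.det_fin_three, Fin.succAbove]

namespace IsNormalForm

variable {A B P : Mat4} {l₁ l₂ p q a₁ a₂ g h : ℝ}

lemma dotProduct_smul_sub (N : IsNormalForm A B P l₁ l₂ p q a₁ a₂ g h) (μ : ℝ)
    (w : Fin 4 → ℝ) : (P *ᵥ w) ⬝ᵥ ((μ • A - B) *ᵥ (P *ᵥ w)) =
      (μ - l₁) * a₁ * w 0 ^ 2 + (μ - l₂) * a₂ * w 1 ^ 2 +
        ((μ - p) * g + q * h) * (w 2 ^ 2 - w 3 ^ 2) +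
        2 * ((μ - p) * h - q * g) * (w 2 * w 3) := by
  rw [← blockForm_dotProduct, ← N.congr_smul_sub, Matrix.mul_assoc, ← Matrix.mulVec_mulVec,
    Matrix.dotProduct_mulVec w, Matrix.vecMul_transpose, Matrix.mulVec_mulVec]

/-- The intersection curve of a pencil in normal form is a single circle that misses some plane. The
members of the pencil for the two real roots are singular and each omit one of the first two
coordinates; they express the squares of these coordinates as binary forms in the other two. -/
theorem qsic_isCircle (N : IsNormalForm A B P l₁ l₂ p q a₁ a₂ g h) :
    ∃ C : Set RP3, componentsOf (qsic A B) = {C} ∧ IsClosedComponent C ∧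
      Nonempty (C ≃ₜ Circle) := by
  have hl : l₂ - l₁ ≠ 0 := sub_ne_zero.mpr N.lt.ne'
  have ha₁ := N.fst_ne_zero
  have ha₂ := N.snd_ne_zero
  have hq := N.im_ne_zero
  have hgh := N.block_ne_zero
  have hpencil : qsic A B = qsic (l₂ • A - B) (l₁ • A - B) :=
    (qsic_eq_of_generatesSamePencil ⟨l₂, -1, l₁, -1, by
      intro h0; apply hl; linarith, by rw [neg_one_smul, sub_eq_add_neg],
      by rw [neg_one_smul, sub_eq_add_neg]⟩).symm
  obtain ⟨α, β, γ, δ, a, b, c, d, hdet, ha, hb, hc, hd, hlt, hform⟩ :=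
    exists_wedge_coordinates
      (G := ((l₂ - p) * g + q * h) / -((l₂ - l₁) * a₁))
      (H := ((l₂ - p) * h - q * g) / -((l₂ - l₁) * a₁))
      (G' := ((l₁ - p) * g + q * h) / ((l₂ - l₁) * a₂))
      (H' := ((l₁ - p) * h - q * g) / ((l₂ - l₁) * a₂)) (by
        have : ((l₂ - p) * g + q * h) / -((l₂ - l₁) * a₁) *
            (((l₁ - p) * h - q * g) / ((l₂ - l₁) * a₂)) -
            ((l₁ - p) * g + q * h) / ((l₂ - l₁) * a₂) *
            (((l₂ - p) * h - q * g) / -((l₂ - l₁) * a₁)) =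
            q * (g ^ 2 + h ^ 2) / ((l₂ - l₁) * a₁ * a₂) := by
          field_simp
          ring
        rw [this]
        exact div_ne_zero (mul_ne_zero hq hgh) (mul_ne_zero (mul_ne_zero hl ha₁) ha₂))
  have hP' : (P * lastTwoChange α β γ δ).det ≠ 0 := by
    rw [Matrix.det_mul, det_lastTwoChange]
    exact mul_ne_zero N.det_ne_zero hdet
  refine curve_isCircle ha hb hc hd hlt hP' fun w hw => ?_
  obtain ⟨h1, h2⟩ := hform (w 2) (w 3)
  set R := lastTwoChange α β γ δ with hR
  have r0 : (R *ᵥ w) 0 = w 0 := by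
    simp [hR, lastTwoChange, Matrix.mulVec, dotProduct, Fin.sum_univ_four]
  have r1 : (R *ᵥ w) 1 = w 1 := by
    simp [hR, lastTwoChange, Matrix.mulVec, dotProduct, Fin.sum_univ_four]
  have r2 : (R *ᵥ w) 2 = α * w 2 + β * w 3 := by
    simp [hR, lastTwoChange, Matrix.mulVec, dotProduct, Fin.sum_univ_four]
  have r3 : (R *ᵥ w) 3 = γ * w 2 + δ * w 3 := by
    simp [hR, lastTwoChange, Matrix.mulVec, dotProduct, Fin.sum_univ_four]
  rw [hpencil, qsic, Set.mem_inter_iff, mem_quadric_mk, mem_quadric_mk, ← Matrix.mulVec_mulVec,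
    N.dotProduct_smul_sub, N.dotProduct_smul_sub, r0, r1, r2, r3, ← h1, ← h2]
  set X := (α * w 2 + β * w 3) ^ 2 - (γ * w 2 + δ * w 3) ^ 2
  set Y := (α * w 2 + β * w 3) * (γ * w 2 + δ * w 3)
  refine and_congr ?_ ?_
  · constructor
    · intro h0
      field_simp
      linear_combination h0
    · intro h0
      rw [h0]
      field_simp
      ring
  · constructor
    · intro h0
      field_simp
      linear_combination -h0
    · intro h0
      rw [h0]
      field_simp
      ring

end IsNormalForm

/-! ### Change of generators -/

lemma GeneratesSamePencil.trans {A B A' B' A'' B'' : Mat4} (h : GeneratesSamePencil A B A' B')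
    (h' : GeneratesSamePencil A' B' A'' B'') : GeneratesSamePencil A B A'' B'' := by
  obtain ⟨a, b, c, d, hdet, rfl, rfl⟩ := h
  obtain ⟨a', b', c', d', hdet', rfl, rfl⟩ := h'
  refine ⟨a' * a + b' * c, a' * b + b' * d, c' * a + d' * c, c' * b + d' * d, ?_, ?_, ?_⟩
  · have := mul_ne_zero hdet hdet'
    intro h0
    apply this
    linear_combination h0
  · module
  · module

/-- The effect of a change of generators on the projective parameter `[s : t]`. -/
lemma pencil_change {K : Type*} [Field K] (A B : Matrix (Fin 4) (Fin 4) K) {a b c d s t : K}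
    (h : s * b + t * a ≠ 0) :
    ((s * d + t * c) / (s * b + t * a)) • (a • A + b • B) - (c • A + d • B) =
      ((a * d - b * c) / (s * b + t * a)) • (s • A - t • B) := by
  ext i j
  simp only [Matrix.sub_apply, Matrix.smul_apply, Matrix.add_apply, smul_eq_mul]
  field_simp
  ring

/-- Homogeneous coordinates of a point of the real projective line. -/
def homogCoords (x : OnePoint ℝ) : ℝ × ℝ := x.elim (1, 0) fun a => (a, 1)

lemma homogCoords_independent {x y : OnePoint ℝ} (h : x ≠ y) :
    (homogCoords x).1 * (homogCoords y).2 - (homogCoords y).1 * (homogCoords x).2 ≠ 0 := by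
  induction x using OnePoint.rec <;> induction y using OnePoint.rec <;>
    simp_all [homogCoords, sub_eq_zero]

lemma det_homogCoords {A B : Mat4} {x : OnePoint ℝ} (h : IsCharRoot A B (realPoint x)) :
    ((homogCoords x).1 • A - (homogCoords x).2 • B).det = 0 := by
  induction x using OnePoint.rec with
  | infty =>
    have h' : A.det = 0 := h
    simpa [homogCoords] using h'
  | coe a =>
    have h' : ((a : ℂ) • A.map (fun a : ℝ => (a : ℂ)) - B.map (fun b : ℝ => (b : ℂ))).det = 0 := h
    have h2 : (a : ℂ) • A.map (fun a : ℝ => (a : ℂ)) - B.map (fun b : ℝ => (b : ℂ)) =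
        Complex.ofRealHom.mapMatrix (a • A - B) := by
      ext i j
      simp
    rw [h2, ← RingHom.map_det] at h'
    simpa [homogCoords] using h'

/-- If `[s : t]` is a root, then it is not the parameter of the nonsingular member
`a A + b B`. -/
lemma change_denominator_ne_zero {A B : Mat4} {a b s t : ℝ} (hA : (a • A + b • B).det ≠ 0)
    (hst : (s • A - t • B).det = 0) (h0 : s ≠ 0 ∨ t ≠ 0) : s * b + t * a ≠ 0 := by
  intro h
  have e1 : s • (a • A + b • B) = a • (s • A - t • B) := by
    ext i j
    simp only [Matrix.sub_apply, Matrix.smul_apply, Matrix.add_apply, smul_eq_mul]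
    linear_combination B i j * h
  have e2 : t • (a • A + b • B) = (-b) • (s • A - t • B) := by
    ext i j
    simp only [Matrix.sub_apply, Matrix.smul_apply, Matrix.add_apply, smul_eq_mul]
    linear_combination A i j * h
  have d1 := congrArg Matrix.det e1
  have d2 := congrArg Matrix.det e2
  rw [Matrix.det_smul, Matrix.det_smul, hst, mul_zero] at d1 d2
  rcases h0 with h0 | h0
  · exact mul_ne_zero (pow_ne_zero _ h0) hA d1
  · exact mul_ne_zero (pow_ne_zero _ h0) hA d2

/-- Every pair of generators whose first member is nonsingular has a normal form. -/
theorem HasTwoRealRootsAndOneConjPair.exists_normalForm {A B A' B' : Mat4}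
    (hroots : HasTwoRealRootsAndOneConjPair A B) (hA : A.IsSymm) (hB : B.IsSymm)
    (hgen : GeneratesSamePencil A B A' B') (hA' : A'.det ≠ 0) :
    ∃ P l₁ l₂ p q a₁ a₂ g h, IsNormalForm A' B' P l₁ l₂ p q a₁ a₂ g h := by
  obtain ⟨x, y, z, hxy, hz, hset⟩ := hroots
  obtain ⟨a, b, c, d, hdet, rfl, rfl⟩ := hgen
  have hx : (realPoint x) ∈ {ρ : OnePoint ℂ | IsCharRoot A B ρ} := by rw [hset]; simp
  have hy : (realPoint y) ∈ {ρ : OnePoint ℂ | IsCharRoot A B ρ} := by rw [hset]; simp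
  have hzr : (z : OnePoint ℂ) ∈ {ρ : OnePoint ℂ | IsCharRoot A B ρ} := by rw [hset]; simp
  have hzr' : (z • A.map (fun a : ℝ => (a : ℂ)) - B.map (fun b : ℝ => (b : ℂ))).det = 0 := hzr
  have hind := homogCoords_independent hxy
  have hx' := det_homogCoords hx
  have hy' := det_homogCoords hy
  set s₁ := (homogCoords x).1
  set t₁ := (homogCoords x).2
  set s₂ := (homogCoords y).1
  set t₂ := (homogCoords y).2
  have hd₁ : s₁ * b + t₁ * a ≠ 0 := change_denominator_ne_zero hA' hx' (by
    by_contra! h; simp [h.1, h.2] at hind)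
  have hd₂ : s₂ * b + t₂ * a ≠ 0 := change_denominator_ne_zero hA' hy' (by
    by_contra! h; simp [h.1, h.2] at hind)
  have hdz : z * b + 1 * a ≠ 0 := by
    intro h
    have him := congrArg Complex.im h
    have hre := congrArg Complex.re h
    simp [hz] at him
    simp [him] at hre
    simp [him, hre] at hdet
  have r₁ := congrArg Matrix.det (pencil_change A B (c := c) (d := d) hd₁)
  have r₂ := congrArg Matrix.det (pencil_change A B (c := c) (d := d) hd₂)
  have rz := congrArg Matrix.det (pencil_change (A.map (fun a : ℝ => (a : ℂ)))
    (B.map (fun a : ℝ => (a : ℂ))) (c := c) (d := d) hdz)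
  rw [Matrix.det_smul, hx', mul_zero] at r₁
  rw [Matrix.det_smul, hy', mul_zero] at r₂
  rw [Matrix.det_smul, one_smul, hzr', mul_zero] at rz
  set l₁ := (s₁ * d + t₁ * c) / (s₁ * b + t₁ * a) with hl₁
  set l₂ := (s₂ * d + t₂ * c) / (s₂ * b + t₂ * a) with hl₂
  set ζ := (z * d + 1 * c) / (z * b + 1 * a) with hζ
  have hne : l₁ ≠ l₂ := by
    rw [hl₁, hl₂, Ne, div_eq_div_iff hd₁ hd₂, ← sub_eq_zero]
    intro h
    exact mul_ne_zero hdet hind (by linear_combination h)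
  have hζim : ζ.im ≠ 0 := by
    intro h
    -- a real value `r` of `ζ` gives `(d - r b) z = r a - c`
    have h1 : ζ * (z * b + 1 * a) = z * d + 1 * c := div_mul_cancel₀ _ hdz
    have h2 : ζ = (ζ.re : ℂ) := Complex.ext (by simp) (by simpa using h)
    rw [h2] at h1
    have him := congrArg Complex.im h1
    have hre := congrArg Complex.re h1
    simp at him hre
    have h3 : ζ.re * b = d := mul_right_cancel₀ hz (by linear_combination him)
    have h4 : ζ.re * a = c := by linear_combination hre - z.re * h3
    exact hdet (by rw [← h3, ← h4]; ring)
  have hmapA : (a • A + b • B).map (fun a : ℝ => (a : ℂ)) =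
      (a : ℂ) • A.map (fun a : ℝ => (a : ℂ)) + (b : ℂ) • B.map (fun a : ℝ => (a : ℂ)) := by
    ext i j
    simp
  have hmapB : (c • A + d • B).map (fun a : ℝ => (a : ℂ)) =
      (c : ℂ) • A.map (fun a : ℝ => (a : ℂ)) + (d : ℂ) • B.map (fun a : ℝ => (a : ℂ)) := by
    ext i j
    simp
  have hsA : (a • A + b • B).IsSymm := (hA.smul a).add (hB.smul b)
  have hsB : (c • A + d • B).IsSymm := (hA.smul c).add (hB.smul d)
  rw [← hmapA, ← hmapB] at rz
  rcases lt_or_gt_of_ne hne with hlt | hlt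
  · obtain ⟨P, a₁, a₂, g, h, N⟩ := _root_.exists_normalForm hsA hsB hA' hlt r₁ r₂ hζim rz
    exact ⟨P, _, _, _, _, a₁, a₂, g, h, N⟩
  · obtain ⟨P, a₁, a₂, g, h, N⟩ := _root_.exists_normalForm hsA hsB hA' hlt r₂ r₁ hζim rz
    exact ⟨P, _, _, _, _, a₁, a₂, g, h, N⟩

/-- The characteristic equation has only four roots, so that some `n A - B` is nonsingular. -/
lemma HasTwoRealRootsAndOneConjPair.exists_nonsingular {A B : Mat4}
    (hroots : HasTwoRealRootsAndOneConjPair A B) :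
    ∃ A' B', GeneratesSamePencil A B A' B' ∧ A'.det ≠ 0 := by
  obtain ⟨x, y, z, -, -, hset⟩ := hroots
  have hfin : {ρ : OnePoint ℂ | IsCharRoot A B ρ}.Finite := by
    rw [hset]
    exact Set.toFinite _
  by_contra! hcon
  have hinj : Function.Injective fun n : ℕ => (((n : ℂ)) : OnePoint ℂ) :=
    OnePoint.coe_injective.comp Nat.cast_injective
  refine Set.infinite_range_of_injective hinj (hfin.subset ?_)
  rintro _ ⟨n, rfl⟩
  have h0 := hcon ((n : ℝ) • A + (-1 : ℝ) • B) ((1 : ℝ) • A + (0 : ℝ) • B)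
    ⟨n, -1, 1, 0, by norm_num, rfl, rfl⟩
  have h2 : (n : ℂ) • A.map (fun a : ℝ => (a : ℂ)) - B.map (fun b : ℝ => (b : ℂ)) =
      Complex.ofRealHom.mapMatrix ((n : ℝ) • A + (-1 : ℝ) • B) := by
    ext i j
    simp [sub_eq_add_neg]
  change ((n : ℂ) • A.map (fun a : ℝ => (a : ℂ)) - B.map (fun b : ℝ => (b : ℂ))).det = 0
  rw [h2, ← RingHom.map_det, h0, map_zero]

/-- Some nonsingular member of the pencil has index `3`: if the signs of `a₁` and `a₂` agree this is
`± A`, otherwise `± (μ A - B)` with `μ` between the two real roots. -/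
lemma IsNormalForm.exists_matIndex_eq_three {A B P : Mat4} {l₁ l₂ p q a₁ a₂ g h : ℝ}
    (N : IsNormalForm A B P l₁ l₂ p q a₁ a₂ g h) (hA : A.det ≠ 0) :
    ∃ A' B', GeneratesSamePencil A B A' B' ∧ A'.det ≠ 0 ∧ matIndex A' = 3 := by
  obtain ⟨μ, h1, h2⟩ := exists_between N.lt
  have hμ : (μ • A - B).det ≠ 0 := by
    rw [Ne, N.det_smul_sub_eq_zero_iff]
    rintro (h | h)
    · exact h1.ne' h
    · exact h2.ne h
  have hneg : ∀ D : Mat4, D.det ≠ 0 → (-D).det ≠ 0 := fun D hD => by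
    rw [Matrix.det_neg]
    simpa using hD
  have h1' := sub_pos.mpr h1
  have h2' := sub_neg.mpr h2
  rcases lt_or_gt_of_ne N.fst_ne_zero with s1 | s1 <;>
    rcases lt_or_gt_of_ne N.snd_ne_zero with s2 | s2
  · refine ⟨-A, B, ⟨-1, 0, 0, 1, by norm_num, by simp, by simp⟩, hneg _ hA, ?_⟩
    rw [N.matIndex_neg_left, if_pos (by linarith), if_pos (by linarith)]
  · refine ⟨-(μ • A - B), A, ⟨-μ, 1, 1, 0, by norm_num, by module, by simp⟩, hneg _ hμ, ?_⟩
    rw [N.matIndex_neg_smul_sub, if_pos (by nlinarith), if_pos (by nlinarith)]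
  · refine ⟨μ • A - B, A, ⟨μ, -1, 1, 0, by norm_num, by module, by simp⟩, hμ, ?_⟩
    rw [N.matIndex_smul_sub, if_pos (by nlinarith), if_pos (by nlinarith)]
  · refine ⟨A, B, ⟨1, 0, 0, 1, by norm_num, by simp, by simp⟩, hA, ?_⟩
    rw [N.matIndex_left, if_pos s1, if_pos s2]

theorem theorem5 (A B : Mat4) (hA : A.IsSymm) (hB : B.IsSymm)
    (hroots : HasTwoRealRootsAndOneConjPair A B) :
    (∀ A' B' : Mat4, GeneratesSamePencil A B A' B' → A'.det ≠ 0 →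
      ∃ s : List ℕ, HasBarIndexSequence A' B' s ∧ IndexSeqEquiv s [1, 2, 3]) ∧
    (∃ A' B' : Mat4, GeneratesSamePencil A B A' B' ∧ HasBarIndexSequence A' B' [1, 2, 3]) ∧
    (∃ C : Set RP3, componentsOf (qsic A B) = {C} ∧ IsClosedComponent C ∧
      Nonempty (C ≃ₜ Circle)) := by
  obtain ⟨A₀, B₀, hgen₀, hA₀⟩ := hroots.exists_nonsingular
  obtain ⟨P, l₁, l₂, p, q, a₁, a₂, g, h, N⟩ := hroots.exists_normalForm hA hB hgen₀ hA₀
  refine ⟨fun A' B' hgen hA' => ?_, ?_, ?_⟩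
  · obtain ⟨_, _, _, _, _, _, _, _, _, N'⟩ := hroots.exists_normalForm hA hB hgen hA'
    obtain ⟨s, hs, -, hs'⟩ := N'.hasBarIndexSequence hA'
    exact ⟨s, hs, indexSeqEquiv_one_two_three hs'⟩
  · obtain ⟨A₁, B₁, hgen₁, hA₁, hidx⟩ := N.exists_matIndex_eq_three hA₀
    have hgen := hgen₀.trans hgen₁
    obtain ⟨_, _, _, _, _, _, _, _, _, N'⟩ := hroots.exists_normalForm hA hB hgen hA₁
    obtain ⟨s, hs, hlast, hs'⟩ := N'.hasBarIndexSequence hA₁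
    rw [hidx] at hlast
    refine ⟨A₁, B₁, hgen, ?_⟩
    rcases hs' with rfl | rfl | rfl | rfl
    · exact hs
    all_goals simp at hlast
  · rw [← qsic_eq_of_generatesSamePencil hgen₀]
    exact N.qsic_isCircle
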